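/- Let $a$ be an irrational real number, let $\alpha=2\pi a$, $\gamma\in\mathbb R$ and $C_0,C_1\in\mathbb C$. Let $\mathbf D=e^{i\gamma}\mathbb R$ be the line through the origin with direction $e^{i\gamma}$, let $\mathbf P_0=\{z\in\mathbb C:\operatorname{Im}(e^{-i\gamma}z)>0\}$ be the open half-plane bounded by $\mathbf D$ that contains $ie^{i\gamma}$, and let $\mathbf P_1=\mathbb C\setminus\mathbf P_0$ be the complementary closed half-plane. Let $T:\mathbb C\to\mathbb C$ be the piecewise rotation $$T(z)=e^{i\alpha}(z-C_j)+C_j\quad\text{if } z\in\mathbf P_j,\ j\in\{0,1\}.$$ Put $$|||T|||=\sup_{z\in\mathbb C}\big||T(z)|-|z|\big|,\qquad \Delta=-2|C_1-C_0|\sin(\alpha/2)\cos(\gamma+\alpha/2-\beta),\quad \beta=\arg(C_1-C_0),$$ and let $(q_\ell)_{\ell\ge 0}$ be the denominators of the convergents $p_\ell/q_\ell=[a_0;a_1,\dots,a_\ell]$ of the continued fraction expansion of $a$ (so $q_0=1$). Then for every integer $\ell\ge 0$ and every $z\in\mathbb C$ with $$|z|>q_\ell\,|||T|||\left(\tfrac{2}{\pi}q_\ell+1\right)$$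 one has $$\left|\frac{|T^{q_\ell}z|-|z|}{q_\ell}+\frac{\Delta}{\pi}\right|\le\frac1{q_\ell}\left(\Big(8+\frac{\pi}{2q_\ell}\Big)|||T|||+4|\Delta|\right).$$ -/

import Mathlib

namespace PiecewiseRotation

open Complex in
/-- The open half-plane `P₀` bounded by the line `D = e^{iγ}ℝ` through the origin, on the side
that contains `i e^{iγ}`. -/
def openHalf (γ : ℝ) : Set ℂ := {z | 0 < (exp (-(γ * I)) * z).im}

/-- The closed half-plane `P₁`, the complement of `P₀`; it contains the line `D`. -/
def closedHalf (γ : ℝ) : Set ℂ := (openHalf γ)ᶜ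

/-- The rotation `r(z) = e^{iα}(z - C) + C` of angle `α` and centre `C`. -/
noncomputable def rotation (α : ℝ) (C z : ℂ) : ℂ :=
  Complex.exp (α * Complex.I) * (z - C) + C

open Classical in
/-- The piecewise rotation `T`: the rotation of angle `α` with centre `C₀` on the open half-plane
`P₀`, and the rotation of angle `α` with centre `C₁` on the closed half-plane `P₁`. -/
noncomputable def pieceRot (α γ : ℝ) (C₀ C₁ : ℂ) (z : ℂ) : ℂ :=
  if z ∈ openHalf γ then rotation α C₀ z else rotation α C₁ z

/-- `|||T||| = sup_z | |T z| - |z| |`. It is the true (finite) supremum for every piecewise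
rotation, by `bddAbove_pieceRot` below. -/
noncomputable def tripleNorm (T : ℂ → ℂ) : ℝ := ⨆ z : ℂ, |‖T z‖ - ‖z‖|

/-- `Δ = -2 |C₁ - C₀| sin(α/2) cos(γ + α/2 - β)` with `β = arg (C₁ - C₀)`. -/
noncomputable def Delta (α γ : ℝ) (C₀ C₁ : ℂ) : ℝ :=
  -2 * ‖C₁ - C₀‖ * Real.sin (α / 2) * Real.cos (γ + α / 2 - (C₁ - C₀).arg)

/-- `q_ℓ`, the denominator (in lowest terms) of the `ℓ`-th convergent
`p_ℓ / q_ℓ = [a₀; a₁, …, a_ℓ]` of the continued fraction expansion of `a`. -/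
noncomputable def convDen (a : ℝ) (ℓ : ℕ) : ℕ := (a.convergent ℓ).den

theorem abs_norm_rotation_sub_le (α : ℝ) (C z : ℂ) :
    |‖rotation α C z‖ - ‖z‖| ≤ 2 * ‖C‖ := by
  have h1 : ‖Complex.exp (α * Complex.I)‖ = 1 := Complex.norm_exp_ofReal_mul_I α
  have h2 : ‖Complex.exp (α * Complex.I) * z‖ = ‖z‖ := by rw [norm_mul, h1, one_mul]
  have h3 : rotation α C z - Complex.exp (α * Complex.I) * z
      = C - Complex.exp (α * Complex.I) * C := by
    unfold rotation; ring
  calc |‖rotation α C z‖ - ‖z‖|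
      = |‖rotation α C z‖ - ‖Complex.exp (α * Complex.I) * z‖| := by rw [h2]
    _ ≤ ‖rotation α C z - Complex.exp (α * Complex.I) * z‖ := abs_norm_sub_norm_le _ _
    _ = ‖C - Complex.exp (α * Complex.I) * C‖ := by rw [h3]
    _ ≤ ‖C‖ + ‖Complex.exp (α * Complex.I) * C‖ := norm_sub_le _ _
    _ = 2 * ‖C‖ := by rw [norm_mul, h1]; ring

/-- The supremum defining `|||T|||` is over a bounded set when `T` is a piecewise rotation. -/
theorem bddAbove_pieceRot (α γ : ℝ) (C₀ C₁ : ℂ) :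
    BddAbove (Set.range fun z : ℂ => |‖pieceRot α γ C₀ C₁ z‖ - ‖z‖|) := by
  refine ⟨2 * ‖C₀‖ + 2 * ‖C₁‖, ?_⟩
  rintro _ ⟨z, rfl⟩
  have h0 := abs_norm_rotation_sub_le α C₀ z
  have h1 := abs_norm_rotation_sub_le α C₁ z
  have hn0 := norm_nonneg C₀
  have hn1 := norm_nonneg C₁
  simp only [pieceRot]
  split_ifs <;> linarith

end PiecewiseRotation

namespace PiecewiseRotation

open Finset Real

/-! Write `T z = e^{iα}(z + v)`, where `v` takes two values, both of norm at most `N = |||T|||`. Far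
from the origin one step changes `|z|` by nearly `Re(v e^{-iθ})`, `θ = arg z`. With `t` the angle
measured from `e^{iγ}`, this is `P cos t + Q sin t + r side(t) cos t + D |sin t|`
(`re_shiftAt_mul_exp`), with `D = -Δ/2` and `P² + Q² + r² ≤ N²`.

Since `|z|` is large and `|a - p/q| ≤ 1/q²`, the angles of `q` successive points stay close to an
orbit of the rotation by `2πp/q`. Along that exact orbit `cos` and `sin` sum to zero, `|sin|` sums
to `2q/π` up to a bounded error, which produces the main term `-qΔ/π`, and `side · cos` has bounded
sum. The first two estimates survive perturbation by Lipschitz bounds (`norm_sum_exp_le`,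
`abs_sum_abs_sin_sub_le`).

The delicate term is the discontinuous `side · cos`: a small error in angle can cross a jump. It is
dominated by the sawtooth `saw`, and `sawCross` pays for every jump within reach. The orbit is
equidistributed modulo `π`, so few points are near a jump (`sum_saw_le`). Cauchy–Schwarz combines
the bounded sums into `8N`; the second-order errors add up to `πN/(2q)`. The case `q = 1` is
immediate. -/

/-! ### Sums of `π`-periodic functions along rational rotations -/

theorem sum_lattice_coprime {f : ℝ → ℝ} (hf : Function.Periodic f π) {n : ℕ} (hn : 0 < n)
    {P : ℤ} (hP : IsCoprime P n) (x : ℝ) :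
    ∑ k ∈ range n, f (x + π * P * k / n) = ∑ i ∈ range n, f (x + π * i / n) := by
  have hn' : (0 : ℤ) < n := by exact_mod_cast hn
  have hnR : (n : ℝ) ≠ 0 := by positivity
  have hmaps : ∀ k ∈ range n, (P * k % n).toNat ∈ range n := by
    intro k _
    have h1 := Int.emod_nonneg (P * k) hn'.ne'
    have h2 := Int.emod_lt_of_pos (P * k) hn'
    simp only [Finset.mem_range]
    omega
  have hinj : Set.InjOn (fun k : ℕ => (P * k % n).toNat) (range n : Set ℕ) := by
    intro k hk l hl hkl
    simp only [coe_range, Set.mem_Iio] at hk hl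
    have h1 := Int.emod_nonneg (P * k) hn'.ne'
    have h2 := Int.emod_nonneg (P * l) hn'.ne'
    have h3 : P * k % n = P * l % n := by
      simp only at hkl
      omega
    have h4 : (n : ℤ) ∣ P * ((l : ℤ) - k) := by
      rw [mul_sub]
      exact Int.ModEq.dvd h3
    have h5 : (n : ℤ) ∣ (l : ℤ) - k := hP.symm.dvd_of_dvd_mul_left h4
    have h6 : (l : ℤ) - k = 0 := Int.eq_zero_of_abs_lt_dvd h5 (by rw [abs_lt]; omega)
    omega
  refine Finset.sum_nbij (fun k : ℕ => (P * k % n).toNat) hmaps hinj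
    (Finset.surjOn_of_injOn_of_card_le _ hmaps hinj le_rfl) ?_
  intro k _
  have h1 := Int.emod_nonneg (P * k) hn'.ne'
  have h2 := Int.emod_add_mul_ediv (P * k) n
  have h3 : (((P * k % n).toNat : ℕ) : ℝ) = P * k - n * ((P * k / n : ℤ) : ℝ) := by
    have h4 : (((P * k % n).toNat : ℕ) : ℤ) = P * k - n * (P * k / n) := by omega
    exact_mod_cast h4
  have h5 : x + π * P * k / n
      = x + π * (((P * k % n).toNat : ℕ) : ℝ) / n + ((P * k / n : ℤ) : ℝ) * π := by
    rw [h3]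
    field_simp
    ring
  rw [h5]
  exact hf.int_mul _ _

theorem periodic_sum_lattice {f : ℝ → ℝ} (hf : Function.Periodic f π) {n : ℕ} (hn : 0 < n) :
    Function.Periodic (fun x => ∑ i ∈ range n, f (x + π * i / n)) (π / n) := by
  intro x
  have hnR : (n : ℝ) ≠ 0 := by positivity
  have h1 := Finset.sum_range_succ (fun i : ℕ => f (x + π * i / n)) n
  have h2 := Finset.sum_range_succ' (fun i : ℕ => f (x + π * i / n)) n
  have h3 : f (x + π * (n : ℕ) / n) = f (x + π * (0 : ℕ) / n) := by
    have : x + π * (n : ℕ) / n = x + π := by field_simp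
    rw [this, hf]
    simp
  have h4 : ∑ i ∈ range n, f (x + π / n + π * i / n)
      = ∑ i ∈ range n, f (x + π * ((i + 1 : ℕ) : ℝ) / n) := by
    refine Finset.sum_congr rfl fun i _ => ?_
    congr 1
    push_cast
    ring
  linarith

/-- A bound on the sums of a periodic function over the uniform lattices based in one cell holds
along every rational rotation orbit. -/
theorem sum_orbit_le {f : ℝ → ℝ} (hf : Function.Periodic f π) {n : ℕ} (hn : 0 < n)
    {P : ℤ} (hP : IsCoprime P n) {B : ℝ}
    (hB : ∀ u ∈ Set.Ico (0 : ℝ) (π / n), ∑ i ∈ range n, f (u + π * i / n) ≤ B) (x : ℝ) :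
    ∑ k ∈ range n, f (x + π * P * k / n) ≤ B := by
  rw [sum_lattice_coprime hf hn hP]
  obtain ⟨u, hu, hxu⟩ := (periodic_sum_lattice hf hn).exists_mem_Ico₀
    (by positivity : (0 : ℝ) < π / n) x
  rw [hxu]
  exact hB u hu

/-- For odd `q`, `2p` is still a unit modulo `q`, so modulo `π` the orbit meets each point of a
lattice of step `π/q` once. -/
theorem sum_orbit_le_of_odd {f : ℝ → ℝ} (hf : Function.Periodic f π) {q : ℕ} (hq : Odd q)
    {p : ℤ} (hp : IsCoprime p q) {B : ℝ}
    (hB : ∀ u ∈ Set.Ico (0 : ℝ) (π / q), ∑ i ∈ range q, f (u + π * i / q) ≤ B) (x : ℝ) :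
    ∑ k ∈ range q, f (x + 2 * π * p * k / q) ≤ B := by
  have h2 : IsCoprime (2 * p) (q : ℤ) := by
    refine IsCoprime.mul_left ?_ hp
    have : Nat.Coprime 2 q := (Nat.coprime_two_left).2 hq
    exact_mod_cast Nat.isCoprime_iff_coprime.2 this
  have := sum_orbit_le hf hq.pos h2 hB x
  refine le_trans (le_of_eq ?_) this
  refine Finset.sum_congr rfl fun k _ => ?_
  congr 1
  push_cast
  ring

/-- For `q = 2n` the orbit modulo `π` has only `n` points, of step `π/n`, each visited twice. -/
theorem sum_orbit_le_of_even {f : ℝ → ℝ} (hf : Function.Periodic f π) {n : ℕ} (hn : 0 < n)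
    {p : ℤ} (hp : IsCoprime p ((n + n : ℕ) : ℤ)) {B : ℝ}
    (hB : ∀ u ∈ Set.Ico (0 : ℝ) (π / n), ∑ i ∈ range n, f (u + π * i / n) ≤ B) (x : ℝ) :
    ∑ k ∈ range (n + n), f (x + 2 * π * p * k / (n + n : ℕ)) ≤ 2 * B := by
  have hnR : (n : ℝ) ≠ 0 := by positivity
  have h2 : IsCoprime p (n : ℤ) := by
    refine hp.of_isCoprime_of_dvd_right ⟨2, ?_⟩
    push_cast
    ring
  have h := sum_orbit_le hf hn h2 hB x
  rw [Finset.sum_range_add]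
  have e1 : ∀ k : ℕ, f (x + 2 * π * p * k / (n + n : ℕ)) = f (x + π * p * k / n) := by
    intro k
    congr 1
    push_cast
    field_simp
    ring
  have e2 : ∀ k : ℕ, f (x + 2 * π * p * (n + k : ℕ) / (n + n : ℕ)) = f (x + π * p * k / n) := by
    intro k
    rw [← hf.int_mul p (x + π * p * k / n)]
    congr 1
    push_cast
    field_simp
    ring
  rw [Finset.sum_congr rfl fun k _ => e1 k, Finset.sum_congr rfl fun k _ => e2 k]
  linarith

/-! ### Closed forms of trigonometric lattice sums -/

theorem sin_mul_sum_cos {n : ℕ} (hn : 0 < n) (u : ℝ) :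
    sin (π / n / 2) * ∑ i ∈ range n, cos (u + π * i / n) = sin (π / n / 2 - u) := by
  have hnR : (n : ℝ) ≠ 0 := by positivity
  have h : ∀ m : ℕ, sin (π / n / 2) * ∑ i ∈ range m, cos (u + π * i / n)
      = (sin (u + π * m / n - π / n / 2) - sin (u - π / n / 2)) / 2 := by
    intro m
    induction m with
    | zero => simp
    | succ m ih =>
      rw [Finset.sum_range_succ, mul_add, ih]
      have e : u + π * ((m + 1 : ℕ) : ℝ) / n - π / n / 2 = (u + π * m / n) + π / n / 2 := by
        push_cast
        ring
      rw [e, sin_add, sin_sub]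
      ring
  rw [h n]
  have e : u + π * (n : ℝ) / n - π / n / 2 = (u - π / n / 2) + π := by
    field_simp
    ring
  rw [e, sin_add_pi, ← sin_neg (u - π / n / 2), show -(u - π / n / 2) = π / n / 2 - u by ring]
  have := sin_neg (u - π / n / 2)
  rw [show -(u - π / n / 2) = π / n / 2 - u by ring] at this
  linarith

theorem sin_mul_sum_sin {n : ℕ} (hn : 0 < n) (u : ℝ) :
    sin (π / n / 2) * ∑ i ∈ range n, sin (u + π * i / n) = cos (u - π / n / 2) := by
  have h := sin_mul_sum_cos hn (u - π / 2)
  have e : ∀ i : ℕ, cos (u - π / 2 + π * i / n) = sin (u + π * i / n) := by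
    intro i
    rw [← cos_sub_pi_div_two]
    congr 1
    ring
  simp only [e] at h
  rw [h, ← cos_pi_div_two_sub]
  congr 1
  ring

/-! ### Approximation by convergents -/

/-- The `n`-th convergent of an irrational `ξ`, as an unreduced fraction `a / b` that comes with a
Möbius transformation of determinant `±1` expressing `ξ` in its `n`-th complete quotient. -/
theorem exists_convergent_eq_div (n : ℕ) : ∀ {ξ : ℝ}, Irrational ξ →
    ∃ (a b c d : ℤ) (η : ℝ), 1 < η ∧ |a * d - b * c| = 1 ∧ 1 ≤ b ∧ 0 ≤ d ∧
      ξ * (b * η + d) = a * η + c ∧ ξ.convergent n = a / b ∧ (1 < ξ → 1 ≤ a ∧ 0 ≤ c) := by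
  have key : ∀ {ξ : ℝ}, Irrational ξ → 0 < Int.fract ξ := by
    intro ξ hξ
    refine lt_of_le_of_ne (Int.fract_nonneg ξ) fun h => ?_
    refine hξ ⟨⌊ξ⌋, ?_⟩
    have := Int.floor_add_fract ξ
    push_cast
    linarith
  induction n with
  | zero =>
    intro ξ hξ
    have h0 := key hξ
    have h1 := Int.fract_lt_one ξ
    refine ⟨⌊ξ⌋, 1, 1, 0, (Int.fract ξ)⁻¹, (one_lt_inv₀ h0).2 h1, by simp, le_rfl, le_rfl, ?_,
      by simp, fun h => ⟨Int.le_floor.2 (by simpa using h.le), zero_le_one⟩⟩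
    have h2 := Int.floor_add_fract ξ
    have h3 : ξ * (Int.fract ξ)⁻¹ = (⌊ξ⌋ + Int.fract ξ) * (Int.fract ξ)⁻¹ := by rw [h2]
    push_cast
    rw [one_mul, add_zero, h3, add_mul, mul_inv_cancel₀ h0.ne']
  | succ n ih =>
    intro ξ hξ
    have h0 := key hξ
    have h1 := Int.fract_lt_one ξ
    have hirr : Irrational (Int.fract ξ)⁻¹ := by
      have : Irrational (Int.fract ξ) := by
        rw [← Int.self_sub_floor]
        exact hξ.sub_intCast _
      exact this.inv
    obtain ⟨a, b, c, d, η, hη, hdet, hb, hd, hξη, hconv, hpos⟩ := ih hirr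
    obtain ⟨ha, hc⟩ := hpos ((one_lt_inv₀ h0).2 h1)
    -- Substitution of `(aη + c)/(bη + d)` for `ξ'` in `ξ = ⌊ξ⌋ + 1/ξ'`. The old numerators become
    -- the denominators, hence the positivity clause for `1 < ξ`.
    refine ⟨⌊ξ⌋ * a + b, a, ⌊ξ⌋ * c + d, c, η, hη, ?_, ha, hc, ?_, ?_, fun h => ?_⟩
    · rw [← hdet, ← abs_neg]
      congr 1
      ring
    · have h2 := Int.floor_add_fract ξ
      have h3 : Int.fract ξ * (a * η + c) = b * η + d := by
        rw [← hξη, ← mul_assoc, mul_inv_cancel₀ h0.ne', one_mul]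
      push_cast
      calc ξ * (a * η + c) = (⌊ξ⌋ + Int.fract ξ) * (a * η + c) := by rw [h2]
        _ = _ := by rw [add_mul, h3]; ring
    · have haQ : (a : ℚ) ≠ 0 := by exact_mod_cast (by omega : a ≠ 0)
      rw [Real.convergent_succ, hconv]
      push_cast
      field_simp
    · have hf : 1 ≤ ⌊ξ⌋ := Int.le_floor.2 (by simpa using h.le)
      constructor <;> nlinarith

theorem abs_sub_convergent_le {a : ℝ} (ha : Irrational a) (n : ℕ) :
    |a - a.convergent n| ≤ 1 / (convDen a n : ℝ) ^ 2 := by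
  obtain ⟨A, B, C, D, η, hη, hdet, hB, hD, haη, hconv, -⟩ := exists_convergent_eq_div n ha
  have hBR : (1 : ℝ) ≤ B := by exact_mod_cast hB
  have hDR : (0 : ℝ) ≤ D := by exact_mod_cast hD
  have hdetR : |(A : ℝ) * D - B * C| = 1 := by exact_mod_cast hdet
  have hden : (convDen a n : ℝ) ≤ B := by
    have h : ((convDen a n : ℕ) : ℤ) ∣ B := by
      rw [convDen, hconv, ← Rat.divInt_eq_div]
      exact Rat.den_dvd A B
    exact_mod_cast Int.le_of_dvd (by omega) h
  have hpos : (0 : ℝ) < convDen a n := by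
    exact_mod_cast (a.convergent n).den_pos
  have hBη : (B : ℝ) ≤ B * η + D := by nlinarith
  have h1 : a - a.convergent n = -(A * D - B * C) / (B * (B * η + D)) := by
    have hne : (B : ℝ) * η + D ≠ 0 := by linarith
    have hB0 : (B : ℝ) ≠ 0 := by linarith
    have : a = (A * η + C) / (B * η + D) := by rw [eq_div_iff hne, haη]
    rw [hconv]
    push_cast
    nth_rewrite 1 [this]
    rw [div_sub_div _ _ hne hB0, mul_comm (B : ℝ) (B * η + D)]
    congr 1
    ring
  rw [h1, abs_div, abs_neg, hdetR, abs_of_pos (by nlinarith)]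
  gcongr
  nlinarith

/-! ### The sawtooth majorant and its orbit sums -/

/-- The right-continuous `π`-periodic sawtooth that equals `cos` on `[0, π)`. -/
noncomputable def saw (t : ℝ) : ℝ := cos (t - π * ⌊t / π⌋)

theorem floor_add_pi_div_pi (t : ℝ) : ⌊(t + π) / π⌋ = ⌊t / π⌋ + 1 := by
  rw [add_div, div_self pi_ne_zero, Int.floor_add_one]

theorem saw_periodic : Function.Periodic saw π := by
  intro t
  unfold saw
  rw [floor_add_pi_div_pi]
  congr 1
  push_cast
  ring

theorem pi_mul_floor_le (t : ℝ) : π * ⌊t / π⌋ ≤ t := by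
  have h := Int.floor_le (t / π)
  rw [le_div_iff₀ pi_pos] at h
  linarith

theorem lt_pi_mul_floor_add (t : ℝ) : t < π * ⌊t / π⌋ + π := by
  have h := Int.lt_floor_add_one (t / π)
  rw [div_lt_iff₀ pi_pos] at h
  linarith

theorem saw_of_mem {t : ℝ} (h0 : 0 ≤ t) (h1 : t < π) : saw t = cos t := by
  have : ⌊t / π⌋ = 0 := by
    rw [Int.floor_eq_zero_iff]
    exact ⟨by positivity, by rwa [div_lt_one pi_pos]⟩
  simp [saw, this]

theorem abs_cos_sub_cos_le (x y : ℝ) : |cos x - cos y| ≤ |x - y| := by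
  simpa [Real.dist_eq] using Real.lipschitzWith_cos.dist_le_mul x y

theorem abs_sin_sub_sin_le (x y : ℝ) : |sin x - sin y| ≤ |x - y| := by
  simpa [Real.dist_eq] using Real.lipschitzWith_sin.dist_le_mul x y

/-- Apart from its upward jumps of size `2` at the multiples of `π`, the sawtooth decreases at
most at unit speed. -/
theorem saw_sub_saw_le (t x : ℝ) :
    saw t - saw x ≤ 2 * ((⌊t / π⌋ : ℝ) - ⌊x / π⌋) + |t - x| := by
  have ht0 := pi_mul_floor_le t
  have ht1 := lt_pi_mul_floor_add t
  have hx0 := pi_mul_floor_le x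
  have hx1 := lt_pi_mul_floor_add x
  unfold saw
  rcases lt_trichotomy ⌊t / π⌋ ⌊x / π⌋ with h | h | h
  -- Here `t` precedes `x` by at least one jump. The end pieces are compared with `cos π` and `cos
  -- 0`; every further period skipped leaves a surplus `π - 2 ≥ 0`.
  · have hj : (⌊t / π⌋ : ℝ) + 1 ≤ ⌊x / π⌋ := by exact_mod_cast h
    have h1 := (le_abs_self _).trans (abs_cos_sub_cos_le (t - π * ⌊t / π⌋) π)
    have h2 := (le_abs_self _).trans (abs_cos_sub_cos_le 0 (x - π * ⌊x / π⌋))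
    rw [abs_of_nonpos (by linarith), cos_pi] at h1
    rw [abs_of_nonpos (by linarith), cos_zero] at h2
    have h3 := neg_le_abs (t - x)
    have h4 := mul_nonneg (by linarith [pi_gt_three] : (0 : ℝ) ≤ π - 2)
      (by linarith : (0 : ℝ) ≤ (⌊x / π⌋ : ℝ) - (⌊t / π⌋ + 1))
    linarith
  · have h1 := (le_abs_self _).trans
      (abs_cos_sub_cos_le (t - π * ⌊t / π⌋) (x - π * ⌊x / π⌋))
    rw [h] at h1 ⊢
    rw [show t - π * (⌊x / π⌋ : ℝ) - (x - π * ⌊x / π⌋) = t - x by ring] at h1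
    linarith
  · have hj : (⌊x / π⌋ : ℝ) + 1 ≤ ⌊t / π⌋ := by exact_mod_cast h
    have := cos_le_one (t - π * ⌊t / π⌋)
    have := neg_one_le_cos (x - π * ⌊x / π⌋)
    have := abs_nonneg (t - x)
    linarith

theorem lattice_mem {n : ℕ} {u : ℝ} (hu : u ∈ Set.Ico (0 : ℝ) (π / n)) {i : ℕ} (hi : i < n) :
    0 ≤ u + π * i / n ∧ u + π * i / n < π := by
  obtain ⟨h0, h1⟩ := hu
  have hn : (0 : ℝ) < n := by exact_mod_cast (Nat.zero_le i).trans_lt hi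
  have hi' : (i : ℝ) + 1 ≤ n := by exact_mod_cast hi
  refine ⟨by positivity, ?_⟩
  have h2 : π / n * (i + 1) ≤ π / n * n := mul_le_mul_of_nonneg_left hi' (by positivity)
  rw [div_mul_cancel₀ _ hn.ne'] at h2
  have h3 : π * i / n = π / n * i := by ring
  rw [h3]
  linarith

theorem sum_saw_lattice {n : ℕ} {u : ℝ} (hu : u ∈ Set.Ico (0 : ℝ) (π / n)) :
    ∑ i ∈ range n, saw (u + π * i / n) = ∑ i ∈ range n, cos (u + π * i / n) := by
  refine Finset.sum_congr rfl fun i hi => ?_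
  obtain ⟨h0, h1⟩ := lattice_mem hu (Finset.mem_range.1 hi)
  exact saw_of_mem h0 h1

theorem half_cell {n : ℕ} (hn : 0 < n) : 0 < π / n / 2 ∧ π / n / 2 ≤ π / 2 := by
  have hn1 : (1 : ℝ) ≤ n := by exact_mod_cast hn
  have : π / n ≤ π := div_le_self pi_pos.le hn1
  exact ⟨by positivity, by linarith⟩

theorem sum_saw_lattice_le_one {n : ℕ} (hn : 0 < n) {u : ℝ}
    (hu : u ∈ Set.Ico (0 : ℝ) (π / n)) : ∑ i ∈ range n, saw (u + π * i / n) ≤ 1 := by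
  rw [sum_saw_lattice hu]
  obtain ⟨hx0, hx1⟩ := half_cell hn
  have hs : 0 < sin (π / n / 2) := sin_pos_of_pos_of_lt_pi hx0 (by linarith [pi_pos])
  have h := sin_mul_sum_cos hn u
  have hle : sin (π / n / 2 - u) ≤ sin (π / n / 2) :=
    sin_le_sin_of_le_of_le_pi_div_two (by linarith [hu.2]) hx1 (by linarith [hu.1])
  refine le_of_mul_le_mul_left ?_ hs
  rw [h, mul_one]
  exact hle

/-- The closed form gives at most `sin(3h/16)/sin(h/2)` with `h = π/n`; Jordan's inequality bounds
this by `3π/16 < 3/5`. -/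
theorem sum_saw_lattice_le_of_le {n : ℕ} (hn : 0 < n) {u : ℝ}
    (hu : u ∈ Set.Ico (0 : ℝ) (π / n)) (hu' : 5 / 16 * (π / n) ≤ u) :
    ∑ i ∈ range n, saw (u + π * i / n) ≤ 3 / 5 := by
  rw [sum_saw_lattice hu]
  obtain ⟨hx0, hx1⟩ := half_cell hn
  have hs : 0 < sin (π / n / 2) := sin_pos_of_pos_of_lt_pi hx0 (by linarith [pi_pos])
  have h := sin_mul_sum_cos hn u
  have hle : sin (π / n / 2 - u) ≤ sin (3 / 16 * (π / n)) :=
    sin_le_sin_of_le_of_le_pi_div_two (by linarith [hu.2]) (by linarith) (by linarith)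
  have h1 : sin (3 / 16 * (π / n)) ≤ 3 / 16 * (π / n) := sin_le (by linarith)
  have h2 := mul_le_sin hx0.le hx1
  have h3 : 2 / π * (π / n / 2) = 1 / n := by
    field_simp
  rw [h3] at h2
  refine le_of_mul_le_mul_left ?_ hs
  rw [h]
  have h4 : 3 / 16 * (π / n) ≤ 1 / n * (3 / 5) := by
    have : (0 : ℝ) < 1 / n := by
      have : (0 : ℝ) < n := by exact_mod_cast hn
      positivity
    rw [show 3 / 16 * (π / n) = 1 / n * (3 / 16 * π) by ring]
    exact mul_le_mul_of_nonneg_left (by linarith [pi_lt_d2]) this.le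
  nlinarith

/-- The sawtooth plus twice the number of multiples of `π` in `(t, t + e]`. -/
noncomputable def sawCross (e t : ℝ) : ℝ := saw t + 2 * ((⌊(t + e) / π⌋ : ℝ) - ⌊t / π⌋)

theorem sawCross_periodic (e : ℝ) : Function.Periodic (sawCross e) π := by
  intro t
  unfold sawCross
  rw [saw_periodic t, show t + π + e = t + e + π by ring, floor_add_pi_div_pi,
    floor_add_pi_div_pi]
  push_cast
  ring

/-- Replaces a perturbed point by the exact one: all upward jumps met on the way lie in the window
of length `e`, and the majorant remains `π`-periodic. -/
theorem saw_le_sawCross {t x d e : ℝ} (h : |t - x| ≤ d) (hd : d ≤ e) :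
    saw t ≤ sawCross e x + d := by
  have h1 := saw_sub_saw_le t x
  have h2 : (⌊t / π⌋ : ℝ) ≤ ⌊(x + e) / π⌋ := by
    have : t ≤ x + e := by linarith [(le_abs_self _).trans h]
    exact_mod_cast Int.floor_le_floor (div_le_div_of_nonneg_right this pi_pos.le)
  unfold sawCross
  linarith

theorem sum_sawCross_lattice {n : ℕ} {u : ℝ} (hu : u ∈ Set.Ico (0 : ℝ) (π / n)) (e : ℝ) :
    ∑ i ∈ range n, sawCross e (u + π * i / n)
      = ∑ i ∈ range n, saw (u + π * i / n)
        + 2 * ∑ i ∈ range n, (⌊(u + π * i / n + e) / π⌋ : ℝ) := by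
  unfold sawCross
  rw [Finset.sum_add_distrib, ← Finset.mul_sum]
  congr 2
  refine Finset.sum_congr rfl fun i hi => ?_
  obtain ⟨h0, h1⟩ := lattice_mem hu (Finset.mem_range.1 hi)
  have : ⌊(u + π * i / n) / π⌋ = 0 := by
    rw [Int.floor_eq_zero_iff]
    exact ⟨by positivity, by rwa [div_lt_one pi_pos]⟩
  rw [this]
  simp

theorem floor_div_pi_le_zero {t : ℝ} (h : t < π) : (⌊t / π⌋ : ℝ) ≤ 0 := by
  have : ⌊t / π⌋ < 1 := Int.floor_lt.2 (by simpa using (div_lt_one pi_pos).2 h)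
  exact_mod_cast Int.lt_add_one_iff.1 this

theorem floor_div_pi_le_one {t : ℝ} (h : t < 2 * π) : (⌊t / π⌋ : ℝ) ≤ 1 := by
  have : ⌊t / π⌋ < 2 := Int.floor_lt.2 (by
    rw [div_lt_iff₀ pi_pos]
    exact_mod_cast h)
  exact_mod_cast Int.lt_add_one_iff.1 this

/-- The window is `11/8` of a lattice step, so only the last two points can reach `π`: the total is
at most `1 + 2 · 2`. -/
theorem sum_sawCross_le_of_two_windows {n : ℕ} (hn : 2 ≤ n) {u : ℝ}
    (hu : u ∈ Set.Ico (0 : ℝ) (π / n)) :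
    ∑ i ∈ range n, sawCross (11 * π / (8 * n)) (u + π * i / n) ≤ 5 := by
  rw [sum_sawCross_lattice hu]
  have h1 := sum_saw_lattice_le_one (by omega) hu
  obtain ⟨m, rfl⟩ := Nat.exists_eq_add_of_le' hn
  obtain ⟨h, hh⟩ : ∃ h, h = π / ((m + 2 : ℕ) : ℝ) := ⟨_, rfl⟩
  have hpi : π = h * (m + 2) := by
    rw [hh]
    push_cast
    field_simp
  have hpos : 0 < h := by
    rw [hh]
    positivity
  have hu2 : u < h := by
    rw [hh]
    exact hu.2
  have he : ∀ i : ℕ, u + π * i / ((m + 2 : ℕ) : ℝ) + 11 * π / (8 * ((m + 2 : ℕ) : ℝ))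
      = u + h * (i + 11 / 8) := by
    intro i
    rw [hh]
    ring
  simp only [he]
  rw [Finset.sum_range_succ (fun i : ℕ => (⌊(u + h * (i + 11 / 8)) / π⌋ : ℝ)),
    Finset.sum_range_succ (fun i : ℕ => (⌊(u + h * (i + 11 / 8)) / π⌋ : ℝ))]
  have hm : (0 : ℝ) ≤ h * m := by positivity
  have h2 : ∑ i ∈ range m, (⌊(u + h * (i + 11 / 8)) / π⌋ : ℝ) ≤ 0 := by
    refine Finset.sum_nonpos fun i hi => floor_div_pi_le_zero ?_
    have hi' : (i : ℝ) + 1 ≤ m := by exact_mod_cast Finset.mem_range.1 hi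
    have := mul_le_mul_of_nonneg_left hi' hpos.le
    linarith
  have h3 : (⌊(u + h * (m + 11 / 8)) / π⌋ : ℝ) ≤ 1 := floor_div_pi_le_one (by linarith)
  have h4 : (⌊(u + h * ((m + 1 : ℕ) + 11 / 8)) / π⌋ : ℝ) ≤ 1 := by
    refine floor_div_pi_le_one ?_
    push_cast
    linarith
  linarith

/-- The window is `11/16` of a step, so only the last point can reach `π`, and only if `u` is at
least `5/16` of a step. In that case the sawtooth sum is at most `3/5`, giving `3/5 + 2`; otherwise
the total is at most `1`. -/
theorem sum_sawCross_le_of_one_window {n : ℕ} (hn : 1 ≤ n) {u : ℝ}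
    (hu : u ∈ Set.Ico (0 : ℝ) (π / n)) :
    ∑ i ∈ range n, sawCross (11 * π / (8 * (n + n : ℕ))) (u + π * i / n) ≤ 13 / 5 := by
  rw [sum_sawCross_lattice hu]
  have h1 := sum_saw_lattice_le_one (by omega) hu
  have h1' := sum_saw_lattice_le_of_le (by omega) hu
  obtain ⟨m, rfl⟩ := Nat.exists_eq_add_of_le' hn
  obtain ⟨h, hh⟩ : ∃ h, h = π / ((m + 1 : ℕ) : ℝ) := ⟨_, rfl⟩
  have hpi : π = h * (m + 1) := by
    rw [hh]
    push_cast
    field_simp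
  have hpos : 0 < h := by
    rw [hh]
    positivity
  rw [← hh] at h1'
  have hu2 : u < h := by
    rw [hh]
    exact hu.2
  have he : ∀ i : ℕ, u + π * i / ((m + 1 : ℕ) : ℝ)
      + 11 * π / (8 * ((m + 1 + (m + 1) : ℕ) : ℝ)) = u + h * (i + 11 / 16) := by
    intro i
    rw [hh]
    push_cast
    field_simp
    ring
  simp only [he]
  rw [Finset.sum_range_succ (fun i : ℕ => (⌊(u + h * (i + 11 / 16)) / π⌋ : ℝ))]
  have hm : (0 : ℝ) ≤ h * m := by positivity
  have h2 : ∑ i ∈ range m, (⌊(u + h * (i + 11 / 16)) / π⌋ : ℝ) ≤ 0 := by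
    refine Finset.sum_nonpos fun i hi => floor_div_pi_le_zero ?_
    have hi' : (i : ℝ) + 1 ≤ m := by exact_mod_cast Finset.mem_range.1 hi
    have := mul_le_mul_of_nonneg_left hi' hpos.le
    linarith
  have h3 : (⌊(u + h * (m + 11 / 16)) / π⌋ : ℝ) ≤ 1 := floor_div_pi_le_one (by linarith)
  by_cases hc : 5 / 16 * h ≤ u
  · have := h1' hc
    linarith
  · have h4 : (⌊(u + h * (m + 11 / 16)) / π⌋ : ℝ) ≤ 0 := floor_div_pi_le_zero (by linarith)
    linarith

/-- The orbit is followed up to errors `d k` by the rational rotation of angle `2πp/q`. -/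
theorem sum_saw_le {p : ℤ} {q : ℕ} (hq : 2 ≤ q) (hp : IsCoprime p (q : ℤ)) {t d : ℕ → ℝ} {x : ℝ}
    (ht : ∀ k < q, |t k - (x + 2 * π * p * k / q)| ≤ d k)
    (hd : ∀ k < q, d k ≤ 11 * π / (8 * q)) :
    ∑ k ∈ range q, saw (t k) ≤ 26 / 5 + ∑ k ∈ range q, d k := by
  have h1 : ∑ k ∈ range q, saw (t k)
      ≤ ∑ k ∈ range q, sawCross (11 * π / (8 * q)) (x + 2 * π * p * k / q)
        + ∑ k ∈ range q, d k := by
    rw [← Finset.sum_add_distrib]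
    refine Finset.sum_le_sum fun k hk => ?_
    have hk' := Finset.mem_range.1 hk
    exact saw_le_sawCross (ht k hk') (hd k hk')
  refine h1.trans (add_le_add_left ?_ _)
  -- Even `q` gives `2 · 13/5 = 26/5`, odd `q` gives `5`.
  rcases Nat.even_or_odd q with ⟨n, rfl⟩ | hodd
  · have := sum_orbit_le_of_even (sawCross_periodic (11 * π / (8 * (n + n : ℕ)))) (by omega) hp
      (fun u hu => sum_sawCross_le_of_one_window (by omega) hu) x
    linarith
  · have := sum_orbit_le_of_odd (sawCross_periodic (11 * π / (8 * q))) hodd hp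
      (fun u hu => sum_sawCross_le_of_two_windows hq hu) x
    linarith

/-! ### The three kinds of orbit sums -/

/-- `1` on the open upper half-circle and `-1` on the closed lower one. -/
noncomputable def side (t : ℝ) : ℝ := if 0 < sin t then 1 else -1

theorem side_mul_sin (t : ℝ) : side t * sin t = |sin t| := by
  unfold side
  split_ifs with h
  · rw [abs_of_pos h, one_mul]
  · rw [abs_of_nonpos (not_lt.1 h), neg_one_mul]

theorem abs_side_mul_cos_le_one (t : ℝ) : |side t * cos t| ≤ 1 := by
  have : |side t| = 1 := by
    unfold side
    split_ifs <;> simp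
  rw [abs_mul, this, one_mul]
  exact abs_cos_le_one t

theorem side_mul_cos_le_saw (t : ℝ) : side t * cos t ≤ saw t := by
  have h0 := pi_mul_floor_le t
  have h1 := lt_pi_mul_floor_add t
  rcases h0.eq_or_lt with h | h
  · have : saw t = 1 := by
      unfold saw
      rw [show t - π * ⌊t / π⌋ = 0 by linarith, cos_zero]
    rw [this]
    exact (le_abs_self _).trans (abs_side_mul_cos_le_one t)
  · have hs : 0 < sin (t - π * ⌊t / π⌋) :=
      sin_pos_of_pos_of_lt_pi (by linarith) (by linarith)
    unfold saw side
    rw [mul_comm π, cos_sub_int_mul_pi]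
    rw [mul_comm π, sin_sub_int_mul_pi] at hs
    rcases Int.even_or_odd ⌊t / π⌋ with he | ho
    · rw [he.neg_one_zpow] at hs ⊢
      rw [if_pos (by linarith)]
    · rw [ho.neg_one_zpow] at hs ⊢
      rw [if_neg (by linarith)]

/-- Reflection of the upper bound, as `side` is odd off the zeros of `sin`; at those zeros `saw (-t)
= 1` dominates anyway. -/
theorem neg_side_mul_cos_le_saw_neg (t : ℝ) : -(side t * cos t) ≤ saw (-t) := by
  by_cases h : sin t = 0
  · have h2 : saw (-t) = 1 := by
      obtain ⟨n, hn⟩ := sin_eq_zero_iff.1 h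
      have h3 : -t / π = ((-n : ℤ) : ℝ) := by
        rw [← hn]
        push_cast
        field_simp
      unfold saw
      rw [h3, Int.floor_intCast, ← hn]
      push_cast
      rw [show -((n : ℝ) * π) - π * -n = 0 by ring, cos_zero]
    rw [h2]
    exact (neg_le_abs _).trans (abs_side_mul_cos_le_one t)
  · have h1 := side_mul_cos_le_saw (-t)
    have h2 : side (-t) = -side t := by
      unfold side
      rw [sin_neg]
      rcases lt_or_gt_of_ne h with h | h
      · rw [if_pos (by linarith), if_neg (by linarith), neg_neg]
      · rw [if_neg (by linarith), if_pos h]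
    rwa [h2, cos_neg, neg_mul] at h1


theorem abs_sum_side_mul_cos_le {p : ℤ} {q : ℕ} (hq : 2 ≤ q) (hp : IsCoprime p (q : ℤ))
    {t d : ℕ → ℝ} {x : ℝ} (ht : ∀ k < q, |t k - (x + 2 * π * p * k / q)| ≤ d k)
    (hd : ∀ k < q, d k ≤ 11 * π / (8 * q)) :
    |∑ k ∈ range q, side (t k) * cos (t k)| ≤ 26 / 5 + ∑ k ∈ range q, d k := by
  rw [abs_le']
  constructor
  · exact (Finset.sum_le_sum fun k _ => side_mul_cos_le_saw (t k)).trans (sum_saw_le hq hp ht hd)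
  · rw [← Finset.sum_neg_distrib]
    refine (Finset.sum_le_sum fun k _ => neg_side_mul_cos_le_saw_neg (t k)).trans
      (sum_saw_le (p := -p) (x := -x) hq hp.neg_left (fun k hk => ?_) hd)
    rw [← abs_neg]
    convert ht k hk using 2
    push_cast
    ring

theorem abs_sin_periodic : Function.Periodic (fun t => |sin t|) π := by
  intro t
  simp only [sin_add_pi, abs_neg]

/-- With `y = π/(2n)`, both `cos (u - y)` and `sin y / y` lie in `[cos y, 1]`, and `1 - cos y ≤ sin
y`. -/
theorem abs_sum_abs_sin_lattice_sub_le {n : ℕ} (hn : 0 < n) {u : ℝ}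
    (hu : u ∈ Set.Ico (0 : ℝ) (π / n)) :
    |∑ i ∈ range n, |sin (u + π * i / n)| - 2 * n / π| ≤ 1 := by
  have h1 : ∑ i ∈ range n, |sin (u + π * i / n)| = ∑ i ∈ range n, sin (u + π * i / n) := by
    refine Finset.sum_congr rfl fun i hi => ?_
    obtain ⟨h0, h1⟩ := lattice_mem hu (Finset.mem_range.1 hi)
    exact abs_of_nonneg (sin_nonneg_of_nonneg_of_le_pi h0 h1.le)
  rw [h1]
  have h := sin_mul_sum_sin hn u
  obtain ⟨hx0, hx1⟩ := half_cell hn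
  have hnR : (0 : ℝ) < n := by exact_mod_cast hn
  obtain ⟨y, hy⟩ : ∃ y, y = π / n / 2 := ⟨_, rfl⟩
  have h2 : 2 * n / π = 1 / y := by
    rw [hy]
    field_simp
  have hu0 := hu.1
  have hu1 := hu.2
  rw [h2]
  rw [← hy] at h hx0 hx1
  have huy : u < 2 * y := by
    rw [hy]
    linarith
  have hs : 0 < sin y := sin_pos_of_pos_of_lt_pi hx0 (by linarith [pi_pos])
  have hc : 0 ≤ cos y := cos_nonneg_of_neg_pi_div_two_le_of_le (by linarith) hx1
  have hcu : cos y ≤ cos (u - y) := by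
    rw [← cos_abs (u - y)]
    exact cos_le_cos_of_nonneg_of_le_pi (abs_nonneg _) (by linarith [pi_pos])
      (abs_le.2 ⟨by linarith, by linarith⟩)
  have hcu1 := cos_le_one (u - y)
  have hsy : sin y * (1 / y) ≤ 1 := by
    rw [mul_one_div, div_le_one hx0]
    exact sin_le hx0.le
  have hcy : cos y ≤ sin y * (1 / y) := by
    rw [mul_one_div, le_div_iff₀ hx0]
    rcases hx1.eq_or_lt with h3 | h3
    · rw [h3]
      simp
    · have h4 := lt_tan hx0 h3
      have h5 : 0 < cos y := cos_pos_of_mem_Ioo ⟨by linarith, h3⟩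
      rw [tan_eq_sin_div_cos, lt_div_iff₀ h5] at h4
      linarith
  have hsc : 1 ≤ sin y + cos y := by
    nlinarith [sin_sq_add_cos_sq y, mul_nonneg hs.le hc]
  have h6 : sin y * (∑ i ∈ range n, sin (u + π * i / n) - 1 / y)
      = cos (u - y) - sin y * (1 / y) := by
    rw [mul_sub, h]
  refine abs_le.2 ⟨le_of_mul_le_mul_left ?_ hs, le_of_mul_le_mul_left ?_ hs⟩
  · rw [h6]
    linarith
  · rw [h6]
    linarith

theorem abs_sum_abs_sin_sub_le {p : ℤ} {q : ℕ} (hq : 2 ≤ q) (hp : IsCoprime p (q : ℤ))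
    {t d : ℕ → ℝ} {x : ℝ} (ht : ∀ k < q, |t k - (x + 2 * π * p * k / q)| ≤ d k) :
    |∑ k ∈ range q, |sin (t k)| - 2 * q / π| ≤ 2 + ∑ k ∈ range q, d k := by
  have hlat : |∑ k ∈ range q, |sin (x + 2 * π * p * k / q)| - 2 * q / π| ≤ 2 := by
    have hper : Function.Periodic (fun t => -|sin t|) π := fun t => by
      simp only [sin_add_pi, abs_neg]
    rcases Nat.even_or_odd q with ⟨n, rfl⟩ | hodd
    · have h1 := sum_orbit_le_of_even abs_sin_periodic (by omega) hp (B := 2 * n / π + 1)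
        (fun u hu => by
          linarith [(abs_le.1 (abs_sum_abs_sin_lattice_sub_le (by omega) hu)).2]) x
      have h2 := sum_orbit_le_of_even hper (by omega) hp (B := -(2 * n / π) + 1)
        (fun u hu => by
          rw [Finset.sum_neg_distrib]
          linarith [(abs_le.1 (abs_sum_abs_sin_lattice_sub_le (by omega) hu)).1]) x
      rw [Finset.sum_neg_distrib] at h2
      have h3 : 2 * ((n + n : ℕ) : ℝ) / π = 2 * (2 * n / π) := by
        push_cast
        ring
      rw [h3]
      exact abs_le.2 ⟨by linarith, by linarith⟩
    · have h1 := sum_orbit_le_of_odd abs_sin_periodic hodd hp (B := 2 * q / π + 1)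
        (fun u hu => by
          linarith [(abs_le.1 (abs_sum_abs_sin_lattice_sub_le (by omega) hu)).2]) x
      have h2 := sum_orbit_le_of_odd hper hodd hp (B := -(2 * q / π) + 1)
        (fun u hu => by
          rw [Finset.sum_neg_distrib]
          linarith [(abs_le.1 (abs_sum_abs_sin_lattice_sub_le (by omega) hu)).1]) x
      rw [Finset.sum_neg_distrib] at h2
      exact abs_le.2 ⟨by linarith, by linarith⟩
  have hdiff : |∑ k ∈ range q, |sin (t k)|
      - (∑ k ∈ range q, |sin (x + 2 * π * p * k / q)|)|
      ≤ ∑ k ∈ range q, d k := by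
    rw [← Finset.sum_sub_distrib]
    refine (Finset.abs_sum_le_sum_abs _ _).trans (Finset.sum_le_sum fun k hk => ?_)
    exact (abs_abs_sub_abs_le_abs_sub _ _).trans ((abs_sin_sub_sin_le _ _).trans
      (ht k (Finset.mem_range.1 hk)))
  have := abs_sub_le (∑ k ∈ range q, |sin (t k)|)
    (∑ k ∈ range q, |sin (x + 2 * π * p * k / q)|) (2 * q / π)
  linarith

theorem norm_sum_exp_le {p : ℤ} {q : ℕ} (hq : 2 ≤ q) (hp : IsCoprime p (q : ℤ))
    {t d : ℕ → ℝ} {x : ℝ} (ht : ∀ k < q, |t k - (x + 2 * π * p * k / q)| ≤ d k) :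
    ‖∑ k ∈ range q, Complex.exp (t k * Complex.I)‖ ≤ ∑ k ∈ range q, d k := by
  have hlat : ∑ k ∈ range q,
      Complex.exp (((x + 2 * π * p * k / q : ℝ) : ℂ) * Complex.I) = 0 := by
    have h1 := (Complex.isPrimitiveRoot_exp_of_isCoprime p q (by omega) hp).geom_sum_eq_zero hq
    have h2 : ∀ k : ℕ, Complex.exp (((x + 2 * π * p * k / q : ℝ) : ℂ) * Complex.I)
        = Complex.exp (x * Complex.I)
          * Complex.exp (2 * π * Complex.I * (p / q)) ^ k := by
      intro k
      rw [← Complex.exp_nat_mul, ← Complex.exp_add]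
      congr 1
      push_cast
      ring
    rw [Finset.sum_congr rfl fun k _ => h2 k, ← Finset.mul_sum, h1, mul_zero]
  have h3 := Finset.sum_sub_distrib (s := range q)
    (fun k => Complex.exp (t k * Complex.I))
    (fun k : ℕ => Complex.exp (((x + 2 * π * p * k / q : ℝ) : ℂ) * Complex.I))
  rw [hlat, sub_zero] at h3
  rw [← h3]
  refine (norm_sum_le _ _).trans (Finset.sum_le_sum fun k hk => ?_)
  refine le_trans ?_ (ht k (Finset.mem_range.1 hk))
  obtain ⟨y, hy⟩ : ∃ y, y = x + 2 * π * p * k / q := ⟨_, rfl⟩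
  rw [← hy]
  have h4 : Complex.exp (t k * Complex.I) - Complex.exp (y * Complex.I)
      = Complex.exp (y * Complex.I) * (Complex.exp (Complex.I * ((t k - y : ℝ) : ℂ)) - 1) := by
    rw [mul_sub, ← Complex.exp_add, mul_one]
    congr 2
    push_cast
    ring
  rw [h4, norm_mul, Complex.norm_exp_ofReal_mul_I, one_mul]
  exact Real.norm_exp_I_mul_ofReal_sub_one_le

/-- Birkhoff sums over `q` steps, along an orbit that follows the rational rotation of angle
`2πp/q`, of the radial displacement at infinity of a piecewise rotation. -/
theorem abs_sum_displacement_sub_le {p : ℤ} {q : ℕ} (hq : 2 ≤ q) (hp : IsCoprime p (q : ℤ))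
    {t d : ℕ → ℝ} {x : ℝ} (ht : ∀ k < q, |t k - (x + 2 * π * p * k / q)| ≤ d k)
    (hd : ∀ k < q, d k ≤ 11 * π / (8 * q)) (hsum : ∑ k ∈ range q, d k ≤ 11 * π / 16)
    {N P Q r D : ℝ} (hN : 0 ≤ N) (hPQr : P ^ 2 + Q ^ 2 + r ^ 2 ≤ N ^ 2) :
    |∑ k ∈ range q, (P * cos (t k) + Q * sin (t k) + r * (side (t k) * cos (t k))
        + D * |sin (t k)|) - D * (2 * q / π)| ≤ 8 * N + 8 * |D| := by
  have hsum' : ∑ k ∈ range q, d k ≤ 217 / 100 := by linarith [pi_lt_d2]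
  have hE := (norm_sum_exp_le hq hp ht).trans hsum'
  have hS := (abs_sum_side_mul_cos_le hq hp ht hd).trans (add_le_add_right hsum' _)
  have hA := (abs_sum_abs_sin_sub_le hq hp ht).trans (add_le_add_right hsum' _)
  obtain ⟨E, hEdef⟩ : ∃ E, E = ∑ k ∈ range q, Complex.exp (t k * Complex.I) := ⟨_, rfl⟩
  rw [← hEdef] at hE
  have hre : ∑ k ∈ range q, cos (t k) = E.re := by
    rw [hEdef, Complex.re_sum]
    simp [Complex.exp_ofReal_mul_I_re]
  have him : ∑ k ∈ range q, sin (t k) = E.im := by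
    rw [hEdef, Complex.im_sum]
    simp [Complex.exp_ofReal_mul_I_im]
  obtain ⟨S, hSdef⟩ : ∃ S, S = ∑ k ∈ range q, side (t k) * cos (t k) := ⟨_, rfl⟩
  obtain ⟨A, hAdef⟩ : ∃ A, A = ∑ k ∈ range q, |sin (t k)| := ⟨_, rfl⟩
  rw [← hSdef] at hS
  rw [← hAdef] at hA
  rw [Finset.sum_add_distrib, Finset.sum_add_distrib, Finset.sum_add_distrib, ← Finset.mul_sum,
    ← Finset.mul_sum, ← Finset.mul_sum, ← Finset.mul_sum, hre, him, ← hSdef, ← hAdef]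
  have h1 : |P * E.re + Q * E.im + r * S| ≤ 8 * N := by
    refine abs_le_of_sq_le_sq ?_ (by positivity)
    have hE2 : E.re ^ 2 + E.im ^ 2 ≤ (217 / 100) ^ 2 := by
      have h := pow_le_pow_left₀ (norm_nonneg E) hE 2
      rw [Complex.sq_norm, Complex.normSq_apply] at h
      linarith
    have hS2 : S ^ 2 ≤ (26 / 5 + 217 / 100) ^ 2 := by
      rw [← sq_abs S]
      exact pow_le_pow_left₀ (abs_nonneg S) hS 2
    have hCS : (P * E.re + Q * E.im + r * S) ^ 2
        ≤ (P ^ 2 + Q ^ 2 + r ^ 2) * (E.re ^ 2 + E.im ^ 2 + S ^ 2) := by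
      nlinarith [sq_nonneg (P * E.im - Q * E.re), sq_nonneg (P * S - r * E.re),
        sq_nonneg (Q * S - r * E.im)]
    -- `2.17² + 7.37² < 60`: this is the source of the constant `8`.
    have h2 : E.re ^ 2 + E.im ^ 2 + S ^ 2 ≤ 8 ^ 2 := by
      norm_num at hE2 hS2 ⊢
      linarith
    calc (P * E.re + Q * E.im + r * S) ^ 2
        ≤ (P ^ 2 + Q ^ 2 + r ^ 2) * (E.re ^ 2 + E.im ^ 2 + S ^ 2) := hCS
      _ ≤ N ^ 2 * 8 ^ 2 := mul_le_mul hPQr h2 (by positivity) (by positivity)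
      _ = (8 * N) ^ 2 := by ring
  have h2 : |D * (A - 2 * q / π)| ≤ 8 * |D| := by
    rw [abs_mul, mul_comm]
    exact mul_le_mul_of_nonneg_right (hA.trans (by norm_num)) (abs_nonneg D)
  have h3 : P * E.re + Q * E.im + r * S + D * A - D * (2 * q / π)
      = (P * E.re + Q * E.im + r * S) + D * (A - 2 * q / π) := by ring
  rw [h3]
  exact (abs_add_le _ _).trans (add_le_add h1 h2)

theorem sum_abs_sub_half_le (q : ℕ) :
    ∑ k ∈ range q, |(k : ℝ) - (q / 2 : ℕ)| ≤ (q : ℝ) ^ 2 / 4 := by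
  have key : ∀ n : ℕ, ∑ k ∈ range n, |(k : ℝ) - n| = n * (n + 1) / 2 := by
    intro n
    rw [← Finset.sum_range_reflect]
    have : ∀ k ∈ range n, |((n - 1 - k : ℕ) : ℝ) - n| = (k : ℝ) + 1 := by
      intro k hk
      have hk' := Finset.mem_range.1 hk
      rw [show n - 1 - k = n - (k + 1) by omega, Nat.cast_sub (by omega)]
      push_cast
      rw [show (n : ℝ) - (k + 1) - n = -(k + 1) by ring, abs_neg, abs_of_nonneg (by positivity)]
    rw [Finset.sum_congr rfl this]
    clear this
    induction n with
    | zero => simp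
    | succ n ih =>
      rw [Finset.sum_range_succ, ih]
      push_cast
      ring
  have key2 : ∀ n m : ℕ, ∑ k ∈ range m, |((n + k : ℕ) : ℝ) - n| = m * (m - 1) / 2 := by
    intro n m
    induction m with
    | zero => simp
    | succ m ih =>
      rw [Finset.sum_range_succ, ih]
      push_cast
      rw [add_sub_cancel_left, abs_of_nonneg (by positivity)]
      ring
  rcases Nat.even_or_odd' q with ⟨n, rfl | rfl⟩
  · rw [show 2 * n / 2 = n by omega, two_mul, Finset.sum_range_add, key, key2]
    push_cast
    apply le_of_eq
    ring
  · rw [show (2 * n + 1) / 2 = n by omega, show 2 * n + 1 = n + (n + 1) by ring,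
      Finset.sum_range_add, key, key2]
    push_cast
    nlinarith

/-! ### Shifts, radial displacement and `Δ` -/

/-- The vector `v` such that the rotation of angle `α` and centre `C` is `z ↦ e^{iα}(z + v)`. -/
noncomputable def shift (α : ℝ) (C : ℂ) : ℂ := (Complex.exp (-(α * Complex.I)) - 1) * C

theorem rotation_eq (α : ℝ) (C z : ℂ) :
    rotation α C z = Complex.exp (α * Complex.I) * (z + shift α C) := by
  have h : Complex.exp (α * Complex.I) * Complex.exp (-(α * Complex.I)) = 1 := by
    rw [← Complex.exp_add, add_neg_cancel, Complex.exp_zero]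
  unfold rotation shift
  linear_combination (-C) * h

open Classical in
/-- The shift applied by the piecewise rotation at the point `z`. -/
noncomputable def shiftAt (α γ : ℝ) (C₀ C₁ z : ℂ) : ℂ :=
  if z ∈ openHalf γ then shift α C₀ else shift α C₁

theorem pieceRot_eq (α γ : ℝ) (C₀ C₁ z : ℂ) :
    pieceRot α γ C₀ C₁ z = Complex.exp (α * Complex.I) * (z + shiftAt α γ C₀ C₁ z) := by
  unfold pieceRot shiftAt
  split_ifs <;> rw [rotation_eq]

theorem norm_pieceRot (α γ : ℝ) (C₀ C₁ z : ℂ) :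
    ‖pieceRot α γ C₀ C₁ z‖ = ‖z + shiftAt α γ C₀ C₁ z‖ := by
  rw [pieceRot_eq, norm_mul, Complex.norm_exp_ofReal_mul_I, one_mul]

theorem abs_norm_add_shiftAt_sub_le (α γ : ℝ) (C₀ C₁ z : ℂ) :
    |‖z + shiftAt α γ C₀ C₁ z‖ - ‖z‖| ≤ tripleNorm (pieceRot α γ C₀ C₁) := by
  rw [← norm_pieceRot]
  exact le_ciSup (bddAbove_pieceRot α γ C₀ C₁) z

theorem tripleNorm_nonneg (T : ℂ → ℂ) : 0 ≤ tripleNorm T :=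
  Real.iSup_nonneg fun _ => abs_nonneg _

theorem norm_le_abs_of_eq_or_neg {v w : ℂ} (h : w = v ∨ w = -v) : ‖v‖ ≤ |‖w + v‖ - ‖w‖| := by
  rcases h with rfl | rfl
  · rw [← two_mul, norm_mul]
    refine le_trans (le_of_eq ?_) (le_abs_self _)
    norm_num
    ring
  · simp

theorem norm_shift_right_le_tripleNorm (α γ : ℝ) (C₀ C₁ : ℂ) :
    ‖shift α C₁‖ ≤ tripleNorm (pieceRot α γ C₀ C₁) := by
  obtain ⟨w, hw, hwγ⟩ : ∃ w, (w = shift α C₁ ∨ w = -shift α C₁) ∧ w ∉ openHalf γ := by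
    by_cases h : shift α C₁ ∈ openHalf γ
    · refine ⟨-shift α C₁, Or.inr rfl, ?_⟩
      simp only [openHalf, Set.mem_ofPred_eq, mul_neg, Complex.neg_im] at h ⊢
      linarith
    · exact ⟨shift α C₁, Or.inl rfl, h⟩
  have h := abs_norm_add_shiftAt_sub_le α γ C₀ C₁ w
  rw [shiftAt, if_neg hwγ] at h
  exact (norm_le_abs_of_eq_or_neg hw).trans h

/-- Testing at `w = ±v` gives a displacement of at least `‖v‖`. Such a `w` may lie on the boundary
line, outside the open half-plane, so it is pushed inside by `ε/2`. -/
theorem norm_shift_left_le_tripleNorm (α γ : ℝ) (C₀ C₁ : ℂ) :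
    ‖shift α C₀‖ ≤ tripleNorm (pieceRot α γ C₀ C₁) := by
  obtain ⟨w, hw, hwγ⟩ : ∃ w, (w = shift α C₀ ∨ w = -shift α C₀) ∧
      0 ≤ (Complex.exp (-(γ * Complex.I)) * w).im := by
    rcases le_total 0 (Complex.exp (-(γ * Complex.I)) * shift α C₀).im with h | h
    · exact ⟨shift α C₀, Or.inl rfl, h⟩
    · refine ⟨-shift α C₀, Or.inr rfl, ?_⟩
      simp only [mul_neg, Complex.neg_im]
      linarith
  refine le_of_forall_pos_le_add fun ε hε => ?_
  obtain ⟨y, hy⟩ : ∃ y : ℂ, y = ((ε / 2 : ℝ) : ℂ) * (Complex.I * Complex.exp (γ * Complex.I)) :=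
    ⟨_, rfl⟩
  have hyn : ‖y‖ = ε / 2 := by
    rw [hy, norm_mul, norm_mul, Complex.norm_exp_ofReal_mul_I, Complex.norm_I,
      Complex.norm_of_nonneg (by positivity)]
    ring
  have hmem : w + y ∈ openHalf γ := by
    have h : Complex.exp (-(γ * Complex.I)) * y = ((ε / 2 : ℝ) : ℂ) * Complex.I := by
      have : Complex.exp (-(γ * Complex.I)) * Complex.exp (γ * Complex.I) = 1 := by
        rw [← Complex.exp_add, neg_add_cancel, Complex.exp_zero]
      rw [hy]
      linear_combination ((ε / 2 : ℝ) : ℂ) * Complex.I * this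
    simp only [openHalf, Set.mem_ofPred_eq]
    rw [mul_add, h, Complex.add_im, Complex.im_ofReal_mul, Complex.I_im]
    linarith
  have h := abs_norm_add_shiftAt_sub_le α γ C₀ C₁ (w + y)
  rw [shiftAt, if_pos hmem] at h
  have h1 := norm_le_abs_of_eq_or_neg hw
  have h2 := abs_norm_sub_norm_le (w + y + shift α C₀) (w + shift α C₀)
  have h3 := abs_norm_sub_norm_le (w + y) w
  rw [show w + y + shift α C₀ - (w + shift α C₀) = y by ring, hyn] at h2
  rw [add_sub_cancel_left, hyn] at h3
  rw [abs_le] at h h2 h3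
  rcases abs_cases (‖w + shift α C₀‖ - ‖w‖) with ⟨h4, _⟩ | ⟨h4, _⟩ <;> rw [h4] at h1 <;> linarith

theorem norm_shiftAt_le_tripleNorm (α γ : ℝ) (C₀ C₁ z : ℂ) :
    ‖shiftAt α γ C₀ C₁ z‖ ≤ tripleNorm (pieceRot α γ C₀ C₁) := by
  unfold shiftAt
  split_ifs
  · exact norm_shift_left_le_tripleNorm α γ C₀ C₁
  · exact norm_shift_right_le_tripleNorm α γ C₀ C₁

theorem abs_norm_iterate_sub_le (α γ : ℝ) (C₀ C₁ z : ℂ) (k : ℕ) :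
    |‖(pieceRot α γ C₀ C₁)^[k] z‖ - ‖z‖| ≤ k * tripleNorm (pieceRot α γ C₀ C₁) := by
  induction k with
  | zero => simp
  | succ k ih =>
    rw [Function.iterate_succ_apply']
    have h := le_ciSup (bddAbove_pieceRot α γ C₀ C₁) ((pieceRot α γ C₀ C₁)^[k] z)
    have h2 := abs_sub_le ‖pieceRot α γ C₀ C₁ ((pieceRot α γ C₀ C₁)^[k] z)‖
      ‖(pieceRot α γ C₀ C₁)^[k] z‖ ‖z‖
    unfold tripleNorm at ih ⊢
    push_cast
    linarith

/-- First-order expansion of the norm along `v` at `z = ρ e^{iθ}`. -/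
theorem abs_norm_add_sub_le {z v : ℂ} {θ : ℝ}
    (hz : z = ‖z‖ * Complex.exp (θ * Complex.I)) (hz0 : 0 < ‖z‖) (hv : 2 * ‖v‖ ≤ ‖z‖) :
    |‖z + v‖ - ‖z‖ - (v * Complex.exp (-(θ * Complex.I))).re| ≤ ‖v‖ ^ 2 / ‖z‖ := by
  obtain ⟨w, hw⟩ : ∃ w, w = v * Complex.exp (-(θ * Complex.I)) := ⟨_, rfl⟩
  have he : ‖Complex.exp (-(θ * Complex.I))‖ = 1 := by
    have := Complex.norm_exp_ofReal_mul_I (-θ)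
    rwa [Complex.ofReal_neg, neg_mul] at this
  have hwn : ‖w‖ = ‖v‖ := by rw [hw, norm_mul, he, mul_one]
  have hzv : ‖z + v‖ = ‖(‖z‖ : ℂ) + w‖ := by
    have h1 : z * Complex.exp (-(θ * Complex.I)) = ‖z‖ := by
      nth_rewrite 1 [hz]
      rw [mul_assoc, ← Complex.exp_add, add_neg_cancel, Complex.exp_zero, mul_one]
    rw [← h1, hw, ← add_mul, norm_mul, he, mul_one]
  have hsq : ‖z + v‖ ^ 2 = ‖z‖ ^ 2 + 2 * ‖z‖ * w.re + ‖v‖ ^ 2 := by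
    have h1 : ∀ r : ℝ, ‖(r : ℂ) + w‖ ^ 2 = r ^ 2 + 2 * r * w.re + ‖w‖ ^ 2 := by
      intro r
      rw [Complex.sq_norm, Complex.sq_norm, Complex.normSq_apply, Complex.normSq_apply,
        Complex.add_re, Complex.add_im, Complex.ofReal_re, Complex.ofReal_im]
      ring
    rw [hzv, h1, hwn]
  have hc := Complex.abs_re_le_norm w
  rw [hwn] at hc
  rw [← hw]
  have hc2 := sq_le_sq' (by linarith [(abs_le.1 hc).1]) (abs_le.1 hc).2
  have hc1 := (abs_le.1 hc).1
  have hX : ‖z‖ + w.re ≤ ‖z + v‖ :=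
    (le_abs_self _).trans (abs_le_of_sq_le_sq (by nlinarith) (norm_nonneg _))
  rw [abs_of_nonneg (by linarith), le_div_iff₀ hz0]
  -- Difference of squares: `(‖z+v‖ - ‖z‖ - c)(‖z+v‖ + ‖z‖ + c) ≤ ‖v‖²` with `c = w.re`, and the
  -- second factor is at least `‖z‖` because `2‖v‖ ≤ ‖z‖`.
  nlinarith [sq_nonneg w.re]

theorem abs_arg_one_add_le {w : ℂ} (hw : ‖w‖ ≤ 1 / 2) : |(1 + w).arg| ≤ 3 / 2 * ‖w‖ := by
  have h := Complex.abs_im_le_norm (Complex.log (1 + w))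
  rw [Complex.log_im] at h
  exact h.trans (Complex.norm_log_one_add_half_le_self hw)

theorem Delta_eq (α γ : ℝ) (C₀ C₁ : ℂ) :
    Delta α γ C₀ C₁ = (shift α C₁ * Complex.exp (-(γ * Complex.I))).im
      - (shift α C₀ * Complex.exp (-(γ * Complex.I))).im := by
  obtain ⟨β, hβ⟩ : ∃ β, β = (C₁ - C₀).arg := ⟨_, rfl⟩
  have h1 : shift α C₁ * Complex.exp (-(γ * Complex.I))
      - shift α C₀ * Complex.exp (-(γ * Complex.I))
      = (‖C₁ - C₀‖ : ℂ) * (Complex.exp (((β - γ - α : ℝ) : ℂ) * Complex.I)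
        - Complex.exp (((β - γ : ℝ) : ℂ) * Complex.I)) := by
    have h2 := Complex.norm_mul_exp_arg_mul_I (C₁ - C₀)
    rw [← hβ] at h2
    have h3 : Complex.exp (((β - γ - α : ℝ) : ℂ) * Complex.I)
        = Complex.exp (β * Complex.I) * Complex.exp (-(γ * Complex.I))
          * Complex.exp (-(α * Complex.I)) := by
      rw [← Complex.exp_add, ← Complex.exp_add]
      congr 1
      push_cast
      ring
    have h4 : Complex.exp (((β - γ : ℝ) : ℂ) * Complex.I)
        = Complex.exp (β * Complex.I) * Complex.exp (-(γ * Complex.I)) := by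
      rw [← Complex.exp_add]
      congr 1
      push_cast
      ring
    rw [h3, h4]
    unfold shift
    linear_combination (-(Complex.exp (-(γ * Complex.I))
      * (Complex.exp (-(α * Complex.I)) - 1))) * h2
  rw [← Complex.sub_im, h1, Complex.im_ofReal_mul, Complex.sub_im, Complex.exp_ofReal_mul_I_im,
    Complex.exp_ofReal_mul_I_im, sin_sub_sin, Delta, ← hβ]
  have e1 : (β - γ - α - (β - γ)) / 2 = -(α / 2) := by ring
  have e2 : (β - γ - α + (β - γ)) / 2 = -(γ + α / 2 - β) := by ring
  rw [e1, e2, sin_neg, cos_neg]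
  ring

theorem abs_sub_le_of_step {u : ℕ → ℝ} {c : ℝ} {q : ℕ} (hu : ∀ i < q, |u (i + 1) - u i| ≤ c)
    {k m : ℕ} (hk : k ≤ q) (hm : m ≤ q) : |u k - u m| ≤ c * |(k : ℝ) - m| := by
  have key : ∀ j m : ℕ, m + j ≤ q → |u (m + j) - u m| ≤ c * j := by
    intro j m
    induction j with
    | zero => simp
    | succ j ih =>
      intro h
      have h1 := ih (by omega)
      have h2 := hu (m + j) (by omega)
      have h3 := abs_sub_le (u (m + j + 1)) (u (m + j)) (u m)
      push_cast
      rw [← add_assoc]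
      linarith
  rcases le_total m k with h | h
  · obtain ⟨j, rfl⟩ := Nat.exists_eq_add_of_le h
    push_cast
    rw [add_sub_cancel_left, Nat.abs_cast]
    exact key j m hk
  · obtain ⟨j, rfl⟩ := Nat.exists_eq_add_of_le h
    push_cast
    rw [abs_sub_comm, sub_add_cancel_left, abs_neg, Nat.abs_cast]
    exact key j k hm

/-! ### Angles along the orbit and the final estimate -/

/-- A continuous determination, along the orbit of `z`, of the argument measured from the
direction `e^{iγ}`. -/
noncomputable def angle (α γ : ℝ) (C₀ C₁ z : ℂ) (k : ℕ) : ℝ :=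
  z.arg - γ + ∑ i ∈ range k, (α + (1 + shiftAt α γ C₀ C₁ ((pieceRot α γ C₀ C₁)^[i] z)
    / (pieceRot α γ C₀ C₁)^[i] z).arg)

theorem iterate_eq_norm_mul_exp_angle {α γ : ℝ} {C₀ C₁ z : ℂ} {k : ℕ}
    (h0 : ∀ i ≤ k, (pieceRot α γ C₀ C₁)^[i] z ≠ 0) :
    (pieceRot α γ C₀ C₁)^[k] z = ‖(pieceRot α γ C₀ C₁)^[k] z‖
      * Complex.exp (((γ + angle α γ C₀ C₁ z k : ℝ) : ℂ) * Complex.I) := by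
  induction k with
  | zero =>
    simp only [Function.iterate_zero, id_eq, angle, Finset.sum_range_zero, add_zero,
      add_sub_cancel]
    exact (Complex.norm_mul_exp_arg_mul_I z).symm
  | succ k ih =>
    have ih' := ih fun i hi => h0 i (by omega)
    have hk := h0 k (by omega)
    have hang : angle α γ C₀ C₁ z (k + 1) = angle α γ C₀ C₁ z k
        + (α + (1 + shiftAt α γ C₀ C₁ ((pieceRot α γ C₀ C₁)^[k] z)
          / (pieceRot α γ C₀ C₁)^[k] z).arg) := by
      unfold angle
      rw [Finset.sum_range_succ, add_assoc]
    rw [Function.iterate_succ_apply', norm_pieceRot, pieceRot_eq, hang]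
    obtain ⟨y, hy⟩ : ∃ y, y = (pieceRot α γ C₀ C₁)^[k] z := ⟨_, rfl⟩
    rw [← hy] at ih' hk ⊢
    obtain ⟨v, hv⟩ : ∃ v, v = shiftAt α γ C₀ C₁ y := ⟨_, rfl⟩
    rw [← hv]
    have h1 : y + v = y * (1 + v / y) := by
      field_simp
    have h2 := Complex.norm_mul_exp_arg_mul_I (1 + v / y)
    have h3 : Complex.exp (((γ + (angle α γ C₀ C₁ z k + (α + (1 + v / y).arg)) : ℝ) : ℂ)
        * Complex.I) = Complex.exp (((γ + angle α γ C₀ C₁ z k : ℝ) : ℂ) * Complex.I)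
          * Complex.exp (α * Complex.I) * Complex.exp ((1 + v / y).arg * Complex.I) := by
      rw [← Complex.exp_add, ← Complex.exp_add]
      congr 1
      push_cast
      ring
    rw [h3, h1, norm_mul]
    calc Complex.exp (α * Complex.I) * (y * (1 + v / y))
        = Complex.exp (α * Complex.I) * ((‖y‖
            * Complex.exp (((γ + angle α γ C₀ C₁ z k : ℝ) : ℂ) * Complex.I))
          * (‖1 + v / y‖ * Complex.exp ((1 + v / y).arg * Complex.I))) := by rw [h2, ← ih']
      _ = _ := by
        push_cast
        ring

/-- The radial displacement at infinity in the direction at angle `t` from `e^{iγ}`. -/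
theorem re_shiftAt_mul_exp {α γ t : ℝ} {C₀ C₁ z : ℂ} (hz0 : 0 < ‖z‖)
    (hz : z = ‖z‖ * Complex.exp (((γ + t : ℝ) : ℂ) * Complex.I)) {V₀ V₁ : ℂ}
    (hV₀ : V₀ = shift α C₀ * Complex.exp (-(γ * Complex.I)))
    (hV₁ : V₁ = shift α C₁ * Complex.exp (-(γ * Complex.I))) :
    (shiftAt α γ C₀ C₁ z * Complex.exp (-(((γ + t : ℝ) : ℂ) * Complex.I))).re
      = (V₀.re + V₁.re) / 2 * cos t + (V₀.im + V₁.im) / 2 * sin t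
        + (V₀.re - V₁.re) / 2 * (side t * cos t) + (V₀.im - V₁.im) / 2 * |sin t| := by
  have hsplit : Complex.exp (-(((γ + t : ℝ) : ℂ) * Complex.I))
      = Complex.exp (-(γ * Complex.I)) * Complex.exp (((-t : ℝ) : ℂ) * Complex.I) := by
    rw [← Complex.exp_add]
    congr 1
    push_cast
    ring
  have hmem : z ∈ openHalf γ ↔ 0 < sin t := by
    have h1 : Complex.exp (-(γ * Complex.I)) * z = ‖z‖ * Complex.exp (t * Complex.I) := by
      nth_rewrite 1 [hz]
      rw [mul_left_comm, ← Complex.exp_add]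
      congr 2
      push_cast
      ring
    simp only [openHalf, Set.mem_ofPred_eq]
    rw [h1, Complex.im_ofReal_mul, Complex.exp_ofReal_mul_I_im]
    exact mul_pos_iff_of_pos_left hz0
  have hre : ∀ V : ℂ, (V * Complex.exp (((-t : ℝ) : ℂ) * Complex.I)).re
      = V.re * cos t + V.im * sin t := by
    intro V
    rw [Complex.mul_re, Complex.exp_ofReal_mul_I_re, Complex.exp_ofReal_mul_I_im, cos_neg,
      sin_neg]
    ring
  rw [← side_mul_sin, hsplit, ← mul_assoc]
  unfold shiftAt side
  by_cases h : 0 < sin t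
  · rw [if_pos (hmem.2 h), if_pos h, ← hV₀, hre]
    ring
  · rw [if_neg (fun h' => h (hmem.1 h')), if_neg h, ← hV₁, hre]
    ring

/-- The left side is at most the mean of `‖V₀‖²` and `‖V₁‖²`. -/
theorem sq_add_sq_add_sq_le {V₀ V₁ : ℂ} {N : ℝ} (h₀ : ‖V₀‖ ≤ N) (h₁ : ‖V₁‖ ≤ N) :
    ((V₀.re + V₁.re) / 2) ^ 2 + ((V₀.im + V₁.im) / 2) ^ 2 + ((V₀.re - V₁.re) / 2) ^ 2
      ≤ N ^ 2 := by
  have h0 := pow_le_pow_left₀ (norm_nonneg V₀) h₀ 2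
  have h1 := pow_le_pow_left₀ (norm_nonneg V₁) h₁ 2
  rw [Complex.sq_norm, Complex.normSq_apply] at h0 h1
  nlinarith [sq_nonneg (V₀.im - V₁.im), sq_nonneg V₀.re, sq_nonneg V₁.re]

theorem norm_mul_exp_neg (v : ℂ) (γ : ℝ) : ‖v * Complex.exp (-(γ * Complex.I))‖ = ‖v‖ := by
  have := Complex.norm_exp_ofReal_mul_I (-γ)
  rw [Complex.ofReal_neg, neg_mul] at this
  rw [norm_mul, this, mul_one]

theorem isCoprime_num_convDen (a : ℝ) (ℓ : ℕ) :
    IsCoprime (a.convergent ℓ).num (convDen a ℓ : ℤ) :=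
  Int.isCoprime_iff_gcd_eq_one.2 (a.convergent ℓ).reduced

theorem abs_iterate_sub_add_le {a α γ : ℝ} {C₀ C₁ : ℂ} (ha : Irrational a) (hα : α = 2 * π * a)
    {ℓ q : ℕ} (hq : q = convDen a ℓ) (hq2 : 2 ≤ q) {z : ℂ} {N : ℝ}
    (hN : N = tripleNorm (pieceRot α γ C₀ C₁)) (hz : q * N * (2 / π * q + 1) < ‖z‖) :
    |‖(pieceRot α γ C₀ C₁)^[q] z‖ - ‖z‖ + q * Delta α γ C₀ C₁ / π|
      ≤ (8 + π / (2 * q)) * N + 4 * |Delta α γ C₀ C₁| := by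
  have hqR : (2 : ℝ) ≤ q := by exact_mod_cast hq2
  have hq0 : (0 : ℝ) < q := by linarith
  have hpi := pi_pos
  have hN0 : 0 ≤ N := hN ▸ tripleNorm_nonneg _
  obtain ⟨Z, hZ⟩ : ∃ Z : ℕ → ℂ, Z = fun k => (pieceRot α γ C₀ C₁)^[k] z := ⟨_, rfl⟩
  obtain ⟨t, ht⟩ : ∃ t : ℕ → ℝ, t = angle α γ C₀ C₁ z := ⟨_, rfl⟩
  -- In the threshold on `‖z‖`, the summand `qN` absorbs the drift over `q` steps.
  have hbig : ∀ k ≤ q, 2 / π * q ^ 2 * N < ‖Z k‖ := by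
    intro k hk
    have h1 := (abs_le.1 (abs_norm_iterate_sub_le α γ C₀ C₁ z k)).1
    rw [← hN] at h1
    have h2 : (k : ℝ) * N ≤ q * N :=
      mul_le_mul_of_nonneg_right (by exact_mod_cast hk) hN0
    rw [hZ]
    simp only
    nlinarith
  have hZpos : ∀ k ≤ q, 0 < ‖Z k‖ := fun k hk => lt_of_le_of_lt (by positivity) (hbig k hk)
  obtain ⟨v, hv⟩ : ∃ v : ℕ → ℂ, v = fun k => shiftAt α γ C₀ C₁ (Z k) := ⟨_, rfl⟩
  have hvN : ∀ k, ‖v k‖ ≤ N := fun k => by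
    rw [hv, hN]
    exact norm_shiftAt_le_tripleNorm _ _ _ _ _
  have hNZ : ∀ k ≤ q, N / ‖Z k‖ ≤ π / (2 * q ^ 2) := by
    intro k hk
    rw [div_le_div_iff₀ (hZpos k hk) (by positivity)]
    have h1 := mul_le_mul_of_nonneg_left (hbig k hk).le hpi.le
    have h2 : π * (2 / π * q ^ 2 * N) = N * (2 * q ^ 2) := by
      field_simp
    linarith
  have hhalf : π / (2 * (q : ℝ) ^ 2) ≤ 1 / 2 := by
    rw [div_le_div_iff₀ (by positivity) (by norm_num)]
    nlinarith [pi_lt_d2]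
  have hpolar : ∀ k ≤ q, Z k
      = ‖Z k‖ * Complex.exp (((γ + t k : ℝ) : ℂ) * Complex.I) := by
    intro k hk
    rw [hZ, ht]
    refine iterate_eq_norm_mul_exp_angle fun i hi => ?_
    have := hZpos i (hi.trans hk)
    rw [hZ] at this
    exact norm_pos_iff.1 this
  -- the angles follow the rational rotation
  obtain ⟨m, hm⟩ : ∃ m, m = q / 2 := ⟨_, rfl⟩
  obtain ⟨p, hp⟩ : ∃ p, p = (a.convergent ℓ).num := ⟨_, rfl⟩
  have happ : |α - 2 * π * p / q| ≤ 2 * π / q ^ 2 := by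
    have h1 := abs_sub_convergent_le ha ℓ
    have h2 : ((a.convergent ℓ : ℚ) : ℝ) = p / q := by
      rw [hp, hq, convDen]
      exact Rat.cast_def _
    rw [h2, ← hq] at h1
    rw [hα, show 2 * π * a - 2 * π * p / q = 2 * π * (a - p / q) by ring, abs_mul,
      abs_of_pos (by positivity), show 2 * π / (q : ℝ) ^ 2 = 2 * π * (1 / q ^ 2) by ring]
    exact mul_le_mul_of_nonneg_left h1 (by positivity)
  have hstep : ∀ i < q, |(t (i + 1) - (i + 1 : ℕ) * α) - (t i - i * α)|
      ≤ 3 * π / (4 * q ^ 2) := by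
    intro i hi
    have h1 : (t (i + 1) - (i + 1 : ℕ) * α) - (t i - i * α) = (1 + v i / Z i).arg := by
      rw [ht, hv, hZ]
      unfold angle
      rw [Finset.sum_range_succ]
      push_cast
      ring
    have h2 : ‖v i / Z i‖ ≤ π / (2 * q ^ 2) := by
      rw [norm_div]
      exact (div_le_div_of_nonneg_right (hvN i) (norm_nonneg _)).trans (hNZ i hi.le)
    rw [h1]
    refine (abs_arg_one_add_le (h2.trans hhalf)).trans ?_
    have h3 : 3 * π / (4 * (q : ℝ) ^ 2) = 3 / 2 * (π / (2 * q ^ 2)) := by ring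
    rw [h3]
    linarith
  -- `11/4 = 3/4 + 2`: drift of the argument plus error of the convergent. Comparing from the middle
  -- index `m` keeps `|k - m| ≤ q/2`, which the window `11π/(8q)` requires.
  have hfollow : ∀ k < q, |t k - (t m - 2 * π * p * m / q + 2 * π * p * k / q)|
      ≤ 11 * π / (4 * q ^ 2) * |(k : ℝ) - m| := by
    intro k hk
    have h1 := abs_sub_le_of_step (u := fun i => t i - i * α) hstep hk.le
      (show m ≤ q by omega)
    have h2 : t k - (t m - 2 * π * p * m / q + 2 * π * p * k / q)
        = ((t k - k * α) - (t m - m * α)) + (α - 2 * π * p / q) * (k - m) := by ring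
    rw [h2]
    refine (abs_add_le _ _).trans ?_
    rw [abs_mul]
    have h3 := mul_le_mul_of_nonneg_right happ (abs_nonneg ((k : ℝ) - m))
    have h4 : 11 * π / (4 * (q : ℝ) ^ 2) = 3 * π / (4 * q ^ 2) + 2 * π / q ^ 2 := by
      field_simp
      ring
    rw [h4, add_mul]
    exact add_le_add h1 h3
  have hdev : ∀ k < q, 11 * π / (4 * (q : ℝ) ^ 2) * |(k : ℝ) - m| ≤ 11 * π / (8 * q) := by
    intro k hk
    have h1 : |(k : ℝ) - m| ≤ q / 2 := by
      have h2 : (2 * k : ℝ) ≤ 2 * m + q := by exact_mod_cast (by omega : 2 * k ≤ 2 * m + q)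
      have h3 : (2 * m : ℝ) ≤ 2 * k + q := by exact_mod_cast (by omega : 2 * m ≤ 2 * k + q)
      exact abs_le.2 ⟨by linarith, by linarith⟩
    calc 11 * π / (4 * (q : ℝ) ^ 2) * |(k : ℝ) - m| ≤ 11 * π / (4 * (q : ℝ) ^ 2) * (q / 2) :=
          mul_le_mul_of_nonneg_left h1 (by positivity)
      _ = 11 * π / (8 * q) := by
        field_simp
        ring
  have hdevsum : ∑ k ∈ range q, 11 * π / (4 * (q : ℝ) ^ 2) * |(k : ℝ) - m| ≤ 11 * π / 16 := by
    rw [← Finset.mul_sum, hm]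
    calc 11 * π / (4 * (q : ℝ) ^ 2) * ∑ k ∈ range q, |(k : ℝ) - (q / 2 : ℕ)|
        ≤ 11 * π / (4 * (q : ℝ) ^ 2) * (q ^ 2 / 4) :=
          mul_le_mul_of_nonneg_left (sum_abs_sub_half_le q) (by positivity)
      _ = 11 * π / 16 := by
        field_simp
        ring
  -- the radial displacements
  obtain ⟨V₀, hV₀⟩ : ∃ V₀, V₀ = shift α C₀ * Complex.exp (-(γ * Complex.I)) := ⟨_, rfl⟩
  obtain ⟨V₁, hV₁⟩ : ∃ V₁, V₁ = shift α C₁ * Complex.exp (-(γ * Complex.I)) := ⟨_, rfl⟩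
  have hV₀N : ‖V₀‖ ≤ N := by
    rw [hV₀, norm_mul_exp_neg, hN]
    exact norm_shift_left_le_tripleNorm _ _ _ _
  have hV₁N : ‖V₁‖ ≤ N := by
    rw [hV₁, norm_mul_exp_neg, hN]
    exact norm_shift_right_le_tripleNorm _ _ _ _
  have hΔ := Delta_eq α γ C₀ C₁
  rw [← hV₀, ← hV₁] at hΔ
  have hmain := abs_sum_displacement_sub_le hq2
    (by rw [hp, hq]; exact isCoprime_num_convDen a ℓ) hfollow hdev hdevsum hN0
    (sq_add_sq_add_sq_le hV₀N hV₁N) (D := (V₀.im - V₁.im) / 2)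
  obtain ⟨F, hF⟩ : ∃ F : ℕ → ℝ, F = fun k => (V₀.re + V₁.re) / 2 * cos (t k)
    + (V₀.im + V₁.im) / 2 * sin (t k) + (V₀.re - V₁.re) / 2 * (side (t k) * cos (t k))
    + (V₀.im - V₁.im) / 2 * |sin (t k)| := ⟨_, rfl⟩
  have hmain' : |∑ k ∈ range q, F k - (V₀.im - V₁.im) / 2 * (2 * q / π)|
      ≤ 8 * N + 8 * |(V₀.im - V₁.im) / 2| := by
    rw [hF]
    exact hmain
  have herr : ∀ k < q, |‖Z (k + 1)‖ - ‖Z k‖ - F k| ≤ N * (π / (2 * q ^ 2)) := by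
    intro k hk
    have h1 := hNZ k hk.le
    have h2 : ‖Z (k + 1)‖ = ‖Z k + v k‖ := by
      rw [hZ, hv, hZ]
      simp only
      rw [Function.iterate_succ_apply', norm_pieceRot]
    have h3 : F k = (v k * Complex.exp (-(((γ + t k : ℝ) : ℂ) * Complex.I))).re := by
      rw [hv]
      simp only
      rw [re_shiftAt_mul_exp (hZpos k hk.le) (hpolar k hk.le) hV₀ hV₁, hF]
    have h4 : 2 * ‖v k‖ ≤ ‖Z k‖ := by
      have := h1.trans hhalf
      rw [div_le_iff₀ (hZpos k hk.le)] at this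
      linarith [hvN k]
    rw [h2, h3]
    refine (abs_norm_add_sub_le (hpolar k hk.le) (hZpos k hk.le) h4).trans ?_
    calc ‖v k‖ ^ 2 / ‖Z k‖ ≤ N ^ 2 / ‖Z k‖ :=
          div_le_div_of_nonneg_right (pow_le_pow_left₀ (norm_nonneg _) (hvN k) 2)
            (norm_nonneg _)
      _ = N * (N / ‖Z k‖) := by ring
      _ ≤ _ := mul_le_mul_of_nonneg_left h1 hN0
  have htel : ‖(pieceRot α γ C₀ C₁)^[q] z‖ - ‖z‖
      = ∑ k ∈ range q, (‖Z (k + 1)‖ - ‖Z k‖ - F k) + ∑ k ∈ range q, F k := by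
    rw [← Finset.sum_add_distrib]
    simp only [sub_add_cancel]
    rw [Finset.sum_range_sub (fun k => ‖Z k‖), hZ]
    simp
  have hE : |∑ k ∈ range q, (‖Z (k + 1)‖ - ‖Z k‖ - F k)| ≤ π / (2 * q) * N := by
    refine (Finset.abs_sum_le_sum_abs _ _).trans
      ((Finset.sum_le_sum fun k hk => herr k (Finset.mem_range.1 hk)).trans (le_of_eq ?_))
    rw [Finset.sum_const, Finset.card_range, nsmul_eq_mul]
    field_simp
  have hD : |(V₀.im - V₁.im) / 2| = |Delta α γ C₀ C₁| / 2 := by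
    rw [hΔ, abs_div, abs_sub_comm, abs_of_pos (two_pos : (0 : ℝ) < 2)]
  rw [hD] at hmain'
  have hfin : ‖(pieceRot α γ C₀ C₁)^[q] z‖ - ‖z‖ + q * Delta α γ C₀ C₁ / π
      = ∑ k ∈ range q, (‖Z (k + 1)‖ - ‖Z k‖ - F k)
        + (∑ k ∈ range q, F k - (V₀.im - V₁.im) / 2 * (2 * q / π)) := by
    rw [htel, hΔ]
    ring
  rw [hfin]
  refine (abs_add_le _ _).trans ?_
  linarith

end PiecewiseRotation

theorem mainTheorem3 (a α γ : ℝ) (C₀ C₁ : ℂ) (ha : Irrational a) (hα : α = 2 * Real.pi * a)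
    (T : ℂ → ℂ) (hT : T = PiecewiseRotation.pieceRot α γ C₀ C₁)
    (ℓ q : ℕ) (hq : q = PiecewiseRotation.convDen a ℓ) (z : ℂ)
    (hz : ‖z‖ > q * PiecewiseRotation.tripleNorm T * (2 / Real.pi * q + 1)) :
    |(‖T^[q] z‖ - ‖z‖) / q + PiecewiseRotation.Delta α γ C₀ C₁ / Real.pi|
      ≤ 1 / q * ((8 + Real.pi / (2 * q)) * PiecewiseRotation.tripleNorm T
          + 4 * |PiecewiseRotation.Delta α γ C₀ C₁|) := by
  subst hT
  have hqpos : 0 < q := hq ▸ (a.convergent ℓ).den_pos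
  have hqR : (0 : ℝ) < q := by exact_mod_cast hqpos
  have hpi := Real.pi_pos
  have hN := PiecewiseRotation.tripleNorm_nonneg (PiecewiseRotation.pieceRot α γ C₀ C₁)
  have h : |‖(PiecewiseRotation.pieceRot α γ C₀ C₁)^[q] z‖ - ‖z‖
      + q * PiecewiseRotation.Delta α γ C₀ C₁ / Real.pi|
      ≤ (8 + Real.pi / (2 * q))
          * PiecewiseRotation.tripleNorm (PiecewiseRotation.pieceRot α γ C₀ C₁)
        + 4 * |PiecewiseRotation.Delta α γ C₀ C₁| := by
    -- For `q = 1` the roots of unity do not cancel, but one step moves the norm by at most `N`, and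
    -- `|Δ|/π ≤ 4|Δ|`.
    rcases (by omega : q = 1 ∨ 2 ≤ q) with h1 | h2
    · have h3 := PiecewiseRotation.abs_norm_iterate_sub_le α γ C₀ C₁ z q
      refine (abs_add_le _ _).trans (add_le_add (h3.trans ?_) ?_)
      · refine mul_le_mul_of_nonneg_right ?_ hN
        have : 0 < Real.pi / (2 * q) := by positivity
        rw [h1, Nat.cast_one] at this ⊢
        linarith
      · rw [h1, Nat.cast_one, one_mul, abs_div, abs_of_pos hpi, div_le_iff₀ hpi]
        nlinarith [abs_nonneg (PiecewiseRotation.Delta α γ C₀ C₁), Real.pi_gt_three]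
    · exact PiecewiseRotation.abs_iterate_sub_add_le ha hα hq h2 rfl hz
  have h4 : (‖(PiecewiseRotation.pieceRot α γ C₀ C₁)^[q] z‖ - ‖z‖) / q
      + PiecewiseRotation.Delta α γ C₀ C₁ / Real.pi
      = 1 / q * (‖(PiecewiseRotation.pieceRot α γ C₀ C₁)^[q] z‖ - ‖z‖
        + q * PiecewiseRotation.Delta α γ C₀ C₁ / Real.pi) := by
    field_simp
  rw [h4, abs_mul, abs_of_pos (by positivity : (0 : ℝ) < 1 / q)]
  exact mul_le_mul_of_nonneg_left h (by positivity)
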